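/- Let $\mathcal H=\{h_\nu\}_{\nu=1}^\infty$ be a family of convex functions $h_\nu:\mathbb R^n\to\mathbb R$ such that for every $\nu\in\mathbb N$: 1) $h_\nu(x)=h_\nu(|x_1|,\dots,|x_n|)$ for $x\in\mathbb R^n$; 2) the restriction of $h_\nu$ to $[0,\infty)^n$ is nondecreasing in each variable; 3) $\lim_{x\to\infty} h_\nu(x)/\|x\|=+\infty$, where $\|\cdot\|$ is the Euclidean norm; 4) for every $M>0$ there is a constant $A_{\nu,M}>0$ with $h_\nu(x)\le\sum_{1\le j\le n:\,x_j\ne0}x_j\ln\frac{x_j}{M}+A_{\nu,M}$ for $x\in[0,\infty)^n$; 5) there is a constant $\gamma_\nu$ with $h_\nu(x)-h_{\nu+1}(x)\ge\ln2\cdot\sum_{j=1}^n x_j-\gamma_\nu$ for $x\in[0,\infty)^n$; 6) there is a constant $l_\nu$ with $h_{\nu+1}(x+y)\le h_\nu(x)+h_\nu(y)+l_\nu$ for $x,y\in[0,\infty)^n$. Let $G(h_\nu)$ be the space of all $f:\mathbb R^n\to\mathbb C$ such that for every $m\in\mathbb Z_+$ one has $f\in C^m(\mathbb R^n)$ and $$\|f\|_{m,h_\nu}=\sup_{x\in\mathbb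 R^n,\ \beta\in\mathbb Z_+^n,\ |\alpha|\le m}\frac{|x^\beta (D^\alpha f)(x)|}{\beta!\,e^{-h_\nu(\beta)}}<\infty ,$$ with the topology defined by the norms $\|\cdot\|_{m,h_\nu}$ ($m\in\mathbb Z_+$), and let $G(\mathcal H)=\bigcup_{\nu}G(h_\nu)$ carry the (locally convex) inductive limit topology of the spaces $G(h_\nu)$. For a function $g:\mathbb R^n\to\mathbb R$ let $g^*(x)=\sup_{y\in\mathbb R^n}(\langle x,y\rangle-g(y))$ be its Young--Fenchel conjugate, and put $\varphi_\nu(x)=h_\nu^*(\ln(1+|x_1|),\dots,\ln(1+|x_n|))$ for $x\in\mathbb R^n$ (the functions $h_\nu^*$, $\varphi_\nu$ and $\varphi_\nu^*$ are finite everywhere), $\Phi=\{\varphi_\nu\}_{\nu=1}^\infty$ and $\Phi^*=\{\varphi_\nu^*\}_{\nu=1}^\infty$. Let $GS(\varphi_\nu^*)$ be the space of all $f:\mathbb R^n\to\mathbb C$ such that for every $m\in\mathbb Z_+$ one has $f\in C^m(\mathbb R^n)$ and $$q_{m,\nu}(f)=\sup_{x\in\mathbb R^n,\ |\alpha|\le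 m}\frac{|(D^\alpha f)(x)|}{e^{-\varphi_\nu^*(x)}}<\infty ,$$ with the topology defined by the norms $q_{m,\nu}$ ($m\in\mathbb Z_+$), and let $GS(\Phi^*)=\bigcup_\nu GS(\varphi_\nu^*)$ carry the (locally convex) inductive limit topology of the spaces $GS(\varphi_\nu^*)$. If all the functions $\varphi_\nu$ of the family $\Phi$ are convex, then $G(\mathcal H)=GS(\Phi^*)$: the two spaces consist of the same functions and their topologies coincide. -/

import Mathlib

open scoped RealInnerProductSpace

noncomputable section

/-- The vector `(g 0, …, g (n-1))` of `ℝⁿ`, with the Euclidean norm. -/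
def vec {n : ℕ} (g : Fin n → ℝ) : EuclideanSpace ℝ (Fin n) := WithLp.toLp 2 g

/-- A sequence `h ν` of convex functions on `ℝⁿ` with the standing conditions. -/
structure IsWeightFamily {n : ℕ} (h : ℕ → EuclideanSpace ℝ (Fin n) → ℝ) : Prop where
  convex : ∀ ν, ConvexOn ℝ Set.univ (h ν)
  abs_eq : ∀ ν x, h ν x = h ν (vec fun j => |x j|)
  mono : ∀ ν x y, (∀ j, 0 ≤ x j) → (∀ j, x j ≤ y j) → h ν x ≤ h ν y
  superlinear : ∀ ν, Filter.Tendsto (fun x => h ν x / ‖x‖)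
    (Bornology.cobounded (EuclideanSpace ℝ (Fin n))) Filter.atTop
  le_mul_log : ∀ ν, ∀ M : ℝ, 0 < M → ∃ A : ℝ, 0 < A ∧ ∀ x : EuclideanSpace ℝ (Fin n),
    (∀ j, 0 ≤ x j) → h ν x ≤ (∑ j with x j ≠ 0, x j * Real.log (x j / M)) + A
  sub_ge : ∀ ν, ∃ γ : ℝ, ∀ x : EuclideanSpace ℝ (Fin n), (∀ j, 0 ≤ x j) →
    h ν x - h (ν + 1) x ≥ Real.log 2 * (∑ j, x j) - γ
  add_le : ∀ ν, ∃ l : ℝ, ∀ x y : EuclideanSpace ℝ (Fin n), (∀ j, 0 ≤ x j) → (∀ j, 0 ≤ y j) →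
    h (ν + 1) (x + y) ≤ h ν x + h ν y + l

/-- The Young-Fenchel conjugate `g*(x) = sup_y (⟨x, y⟩ - g y)` of a real function on `ℝⁿ`, real
valued: it is only used where the supremum is finite, see `IsWeightFamily.isLUB_conj` and
`IsWeightFamily.isLUB_conj_phi`. -/
def conj {n : ℕ} (g : EuclideanSpace ℝ (Fin n) → ℝ) (x : EuclideanSpace ℝ (Fin n)) : ℝ :=
  ⨆ y, (⟪x, y⟫ - g y)

/-- `φ(x) = h*(ln(1 + |x₁|), …, ln(1 + |xₙ|))`. -/
def phi {n : ℕ} (h : EuclideanSpace ℝ (Fin n) → ℝ) (x : EuclideanSpace ℝ (Fin n)) : ℝ :=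
  conj h (vec fun j => Real.log (1 + |x j|))

theorem bddAbove_conj_of_superlinear {n : ℕ} {g : EuclideanSpace ℝ (Fin n) → ℝ}
    (hg : ConvexOn ℝ Set.univ g)
    (hs : Filter.Tendsto (fun x => g x / ‖x‖)
      (Bornology.cobounded (EuclideanSpace ℝ (Fin n))) Filter.atTop)
    (x : EuclideanSpace ℝ (Fin n)) : BddAbove (Set.range fun y => ⟪x, y⟫ - g y) := by
  have hc : Continuous g := continuousOn_univ.1 (hg.continuousOn isOpen_univ)
  have hev := hs.eventually_ge_atTop ‖x‖
  obtain ⟨R, hR⟩ := (Bornology.IsBounded.subset_closedBall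
    (Bornology.isCobounded_def.2 hev |> Bornology.isBounded_compl_iff.2) 0)
  obtain ⟨B, hB⟩ := ((isCompact_closedBall (0 : EuclideanSpace ℝ (Fin n)) (max R 0)).image
    (f := fun y => ⟪x, y⟫ - g y) (by fun_prop)).bddAbove
  refine ⟨max B 0, ?_⟩
  rintro _ ⟨y, rfl⟩
  by_cases hy : y ∈ Metric.closedBall (0 : EuclideanSpace ℝ (Fin n)) (max R 0)
  · exact le_max_of_le_left (hB ⟨y, hy, rfl⟩)
  · have hpos : 0 < ‖y‖ := by
      rw [mem_closedBall_zero_iff, not_le] at hy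
      exact (le_max_right R 0).trans_lt hy
    have h1 : ‖x‖ ≤ g y / ‖y‖ := by
      by_contra hcon
      exact hy (Metric.closedBall_subset_closedBall (le_max_left R 0) (hR hcon))
    rw [le_div_iff₀ hpos] at h1
    exact le_max_of_le_right (by linarith [real_inner_le_norm x y])

theorem IsWeightFamily.isLUB_conj {n : ℕ} {h : ℕ → EuclideanSpace ℝ (Fin n) → ℝ}
    (hh : IsWeightFamily h) (ν : ℕ) (x : EuclideanSpace ℝ (Fin n)) :
    IsLUB (Set.range fun y => ⟪x, y⟫ - h ν y) (conj (h ν) x) :=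
  isLUB_ciSup (bddAbove_conj_of_superlinear (hh.convex ν) (hh.superlinear ν) x)

theorem IsWeightFamily.isLUB_conj_phi {n : ℕ} {h : ℕ → EuclideanSpace ℝ (Fin n) → ℝ}
    (hh : IsWeightFamily h) (ν : ℕ) (x : EuclideanSpace ℝ (Fin n)) :
    IsLUB (Set.range fun y => ⟪x, y⟫ - phi (h ν) y) (conj (phi (h ν)) x) := by
  refine isLUB_ciSup ?_
  set M : ℝ := Real.exp 1 * (‖x‖ + 1) with hM
  have hx0 : 0 ≤ ‖x‖ := norm_nonneg x
  have hMpos : 0 < M := by positivity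
  obtain ⟨A, -, hA⟩ := hh.le_mul_log ν M hMpos
  refine ⟨A, ?_⟩
  rintro _ ⟨y, rfl⟩
  have key := (hh.isLUB_conj ν (vec fun j => Real.log (1 + |y j|))).1
    ⟨vec fun j => (‖x‖ + 1) * (1 + |y j|), rfl⟩
  have h2 := hA (vec fun j => (‖x‖ + 1) * (1 + |y j|))
    (fun j => by simp only [vec]; positivity)
  have hne : ∀ j, (‖x‖ + 1) * (1 + |y j|) ≠ 0 := fun j => by positivity
  have hlog : ∀ j, Real.log ((‖x‖ + 1) * (1 + |y j|) / M) = Real.log (1 + |y j|) - 1 := by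
    intro j
    have : (‖x‖ + 1) * (1 + |y j|) / M = (1 + |y j|) / Real.exp 1 := by
      rw [hM]; field_simp
    rw [this, Real.log_div (by positivity) (by positivity), Real.log_exp]
  simp only [vec, ne_eq, hne, not_false_eq_true, Finset.filter_true, hlog] at h2
  have h3 : ⟪x, y⟫ ≤ ∑ j, (‖x‖ + 1) * (1 + |y j|) := by
    rw [PiLp.inner_apply]
    refine Finset.sum_le_sum fun j _ => ?_
    have hj : |x j| ≤ ‖x‖ := by simpa using PiLp.norm_apply_le x j
    have : ⟪x j, y j⟫ ≤ |x j| * |y j| := by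
      simpa using real_inner_le_norm (x j) (y j)
    nlinarith [abs_nonneg (y j), mul_le_mul_of_nonneg_right hj (abs_nonneg (y j))]
  have h4 : ⟪(vec fun j => Real.log (1 + |y j|)), vec fun j => (‖x‖ + 1) * (1 + |y j|)⟫ =
      (∑ j, (‖x‖ + 1) * (1 + |y j|) * (Real.log (1 + |y j|) - 1)) +
        ∑ j, (‖x‖ + 1) * (1 + |y j|) := by
    rw [PiLp.inner_apply, ← Finset.sum_add_distrib]
    refine Finset.sum_congr rfl fun j _ => ?_
    simp [vec]
    ring
  simp only at key
  rw [h4] at key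
  change ⟪x, y⟫ - conj (h ν) (vec fun j => Real.log (1 + |y j|)) ≤ A
  simp only [vec] at key ⊢
  linarith

/-- The partial derivative in the `j`-th coordinate. -/
def pderivCoord {n : ℕ} (j : Fin n) (f : EuclideanSpace ℝ (Fin n) → ℂ) :
    EuclideanSpace ℝ (Fin n) → ℂ :=
  fun x => fderiv ℝ f x (EuclideanSpace.single j 1)

/-- Iterated partial derivative along a list of coordinates. -/
def pderivList {n : ℕ} (l : List (Fin n)) (f : EuclideanSpace ℝ (Fin n) → ℂ) :
    EuclideanSpace ℝ (Fin n) → ℂ :=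
  l.foldr pderivCoord f

/-- The list of coordinates in which coordinate `j` occurs `α j` times. -/
def multiIndexList {n : ℕ} (α : Fin n → ℕ) : List (Fin n) :=
  (List.finRange n).flatMap fun j => List.replicate (α j) j

/-- `D^α f = ∂^{|α|} f / ∂x₁^{α₁} ⋯ ∂xₙ^{αₙ}`. -/
def multiDeriv {n : ℕ} (α : Fin n → ℕ) (f : EuclideanSpace ℝ (Fin n) → ℂ) :
    EuclideanSpace ℝ (Fin n) → ℂ :=
  pderivList (multiIndexList α) f

theorem length_multiIndexList {n : ℕ} (α : Fin n → ℕ) :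
    (multiIndexList α).length = ∑ j, α j := by
  simp [multiIndexList, List.length_flatMap, Fin.sum_univ_def]

theorem contDiff_pderivList {n : ℕ} (l : List (Fin n)) :
    ∀ (k : ℕ) (f : EuclideanSpace ℝ (Fin n) → ℂ), ContDiff ℝ ((k + l.length : ℕ)) f →
      ContDiff ℝ k (pderivList l f) := by
  induction l with
  | nil => intro k f hf; simpa [pderivList] using hf
  | cons j l ih =>
    intro k f hf
    have h1 : ContDiff ℝ ((k + 1 : ℕ)) (pderivList l f) :=
      ih (k + 1) f (by
        have e : k + 1 + l.length = k + (j :: l).length := by simp; omega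
        rw [e]; exact hf)
    exact (h1.fderiv_right (m := k) (by norm_cast)).clm_apply contDiff_const

theorem differentiable_pderivList {n : ℕ} (j : Fin n) (l : List (Fin n))
    {f : EuclideanSpace ℝ (Fin n) → ℂ} (hf : ContDiff ℝ ((j :: l).length : ℕ) f) :
    Differentiable ℝ (pderivList l f) := by
  have h1 : ContDiff ℝ ((1 : ℕ)) (pderivList l f) :=
    contDiff_pderivList l 1 f (by
      have e : 1 + l.length = (j :: l).length := by simp; omega
      rw [e]; exact hf)
  exact h1.differentiable (by norm_num)

theorem pderivList_add {n : ℕ} (l : List (Fin n)) {f g : EuclideanSpace ℝ (Fin n) → ℂ}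
    (hf : ContDiff ℝ (l.length : ℕ) f) (hg : ContDiff ℝ (l.length : ℕ) g) :
    pderivList l (f + g) = pderivList l f + pderivList l g := by
  induction l with
  | nil => rfl
  | cons j l ih =>
    have hle : ((l.length : ℕ) : WithTop ℕ∞) ≤ ((j :: l).length : ℕ) := by
      simp only [List.length_cons]; norm_cast; omega
    have e := ih (hf.of_le hle) (hg.of_le hle)
    change pderivCoord j (pderivList l (f + g)) = _
    rw [e]
    funext x
    have hd := fderiv_add (differentiable_pderivList j l hf x) (differentiable_pderivList j l hg x)
    simp [pderivCoord, pderivList, hd] at hd ⊢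

theorem pderivList_smul {n : ℕ} (l : List (Fin n)) (c : ℂ) {f : EuclideanSpace ℝ (Fin n) → ℂ}
    (hf : ContDiff ℝ (l.length : ℕ) f) :
    pderivList l (c • f) = c • pderivList l f := by
  induction l with
  | nil => rfl
  | cons j l ih =>
    have hle : ((l.length : ℕ) : WithTop ℕ∞) ≤ ((j :: l).length : ℕ) := by
      simp only [List.length_cons]; norm_cast; omega
    have e := ih (hf.of_le hle)
    change pderivCoord j (pderivList l (c • f)) = _
    rw [e]
    funext x
    have hd := fderiv_const_smul (differentiable_pderivList j l hf x) c
    simp [pderivCoord, pderivList, hd] at hd ⊢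

theorem multiDeriv_add {n m : ℕ} {α : Fin n → ℕ} (hα : ∑ j, α j ≤ m)
    {f g : EuclideanSpace ℝ (Fin n) → ℂ} (hf : ContDiff ℝ m f) (hg : ContDiff ℝ m g) :
    multiDeriv α (f + g) = multiDeriv α f + multiDeriv α g := by
  rw [← length_multiIndexList] at hα
  exact pderivList_add _ (hf.of_le (by exact_mod_cast hα)) (hg.of_le (by exact_mod_cast hα))

theorem multiDeriv_smul {n m : ℕ} {α : Fin n → ℕ} (hα : ∑ j, α j ≤ m) (c : ℂ)
    {f : EuclideanSpace ℝ (Fin n) → ℂ} (hf : ContDiff ℝ m f) :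
    multiDeriv α (c • f) = c • multiDeriv α f := by
  rw [← length_multiIndexList] at hα
  exact pderivList_smul _ c (hf.of_le (by exact_mod_cast hα))

/-- For a family `w i` of real weights on `ℝⁿ`, the quantities `|w i x (D^α f)(x)|` with
`|α| ≤ m`. -/
def weightedVal {n : ℕ} {ι : Type} (w : ι → EuclideanSpace ℝ (Fin n) → ℝ) (m : ℕ)
    (f : EuclideanSpace ℝ (Fin n) → ℂ)
    (p : {α : Fin n → ℕ // ∑ j, α j ≤ m} × ι × EuclideanSpace ℝ (Fin n)) : ℝ :=
  ‖w p.2.1 p.2.2 • multiDeriv p.1.1 f p.2.2‖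

theorem weightedVal_add_le {n : ℕ} {ι : Type} (w : ι → EuclideanSpace ℝ (Fin n) → ℝ) {m : ℕ}
    {f g : EuclideanSpace ℝ (Fin n) → ℂ} (hf : ContDiff ℝ m f) (hg : ContDiff ℝ m g)
    (p : {α : Fin n → ℕ // ∑ j, α j ≤ m} × ι × EuclideanSpace ℝ (Fin n)) :
    weightedVal w m (f + g) p ≤ weightedVal w m f p + weightedVal w m g p := by
  unfold weightedVal
  rw [multiDeriv_add p.1.2 hf hg, Pi.add_apply, smul_add]
  exact norm_add_le _ _

theorem weightedVal_smul {n : ℕ} {ι : Type} (w : ι → EuclideanSpace ℝ (Fin n) → ℝ) {m : ℕ}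
    {f : EuclideanSpace ℝ (Fin n) → ℂ} (hf : ContDiff ℝ m f) (c : ℂ)
    (p : {α : Fin n → ℕ // ∑ j, α j ≤ m} × ι × EuclideanSpace ℝ (Fin n)) :
    weightedVal w m (c • f) p = ‖c‖ * weightedVal w m f p := by
  unfold weightedVal
  rw [multiDeriv_smul p.1.2 c hf, Pi.smul_apply, smul_comm, norm_smul]

/-- The space of `f ∈ C^m(ℝⁿ)` with `sup |w i x (D^α f)(x)| < ∞`, the supremum being over
`|α| ≤ m`, all `i` and all `x`. -/
def weightedSpaceOrder {n : ℕ} {ι : Type} (w : ι → EuclideanSpace ℝ (Fin n) → ℝ) (m : ℕ) :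
    Submodule ℂ (EuclideanSpace ℝ (Fin n) → ℂ) where
  carrier := {f | ContDiff ℝ m f ∧ BddAbove (Set.range (weightedVal w m f))}
  zero_mem' := by
    have hz : ContDiff ℝ m (0 : EuclideanSpace ℝ (Fin n) → ℂ) := contDiff_const
    refine ⟨hz, 0, ?_⟩
    rintro _ ⟨p, rfl⟩
    have := weightedVal_smul w hz 0 p
    simp at this
    exact this.le
  add_mem' := by
    rintro f g ⟨hf, A, hA⟩ ⟨hg, B, hB⟩
    refine ⟨hf.add hg, A + B, ?_⟩
    rintro _ ⟨p, rfl⟩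
    exact (weightedVal_add_le w hf hg p).trans (add_le_add (hA ⟨p, rfl⟩) (hB ⟨p, rfl⟩))
  smul_mem' := by
    rintro c f ⟨hf, A, hA⟩
    refine ⟨contDiff_const.smul hf, ‖c‖ * A, ?_⟩
    rintro _ ⟨p, rfl⟩
    rw [weightedVal_smul w hf]
    exact mul_le_mul_of_nonneg_left (hA ⟨p, rfl⟩) (norm_nonneg c)

/-- The intersection over all orders `m`. -/
def weightedSpace {n : ℕ} {ι : Type} (w : ι → EuclideanSpace ℝ (Fin n) → ℝ) :
    Submodule ℂ (EuclideanSpace ℝ (Fin n) → ℂ) :=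
  ⨅ m : ℕ, weightedSpaceOrder w m

theorem weightedSpace_prop {n : ℕ} {ι : Type} {w : ι → EuclideanSpace ℝ (Fin n) → ℝ}
    (f : weightedSpace w) (m : ℕ) :
    ContDiff ℝ m (f : EuclideanSpace ℝ (Fin n) → ℂ) ∧
      BddAbove (Set.range (weightedVal w m (f : EuclideanSpace ℝ (Fin n) → ℂ))) :=
  (Submodule.mem_iInf _).1 f.2 m

/-- The `m`-th norm `f ↦ sup |w i x (D^α f)(x)|`, the supremum being over `|α| ≤ m`, all `i` and
all `x`, on the intersection space. -/
def weightedNorm {n : ℕ} {ι : Type} (w : ι → EuclideanSpace ℝ (Fin n) → ℝ) :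
    SeminormFamily ℂ (weightedSpace w) ℕ := fun m =>
  Seminorm.of (fun f => ⨆ p, weightedVal w m (f : EuclideanSpace ℝ (Fin n) → ℂ) p)
    (fun f g => by
      obtain ⟨hf, hfb⟩ := weightedSpace_prop f m
      obtain ⟨hg, hgb⟩ := weightedSpace_prop g m
      refine Real.iSup_le (fun p => ?_) (add_nonneg (Real.iSup_nonneg fun _ => norm_nonneg _)
        (Real.iSup_nonneg fun _ => norm_nonneg _))
      exact (weightedVal_add_le w hf hg p).trans (add_le_add (le_ciSup hfb p) (le_ciSup hgb p)))
    (fun c f => by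
      obtain ⟨hf, -⟩ := weightedSpace_prop f m
      rw [Real.mul_iSup_of_nonneg (norm_nonneg c)]
      exact iSup_congr fun p => weightedVal_smul w hf c p)

/-- The topology on the intersection space defined by the family of norms. -/
@[reducible] def weightedTopology {n : ℕ} {ι : Type} (w : ι → EuclideanSpace ℝ (Fin n) → ℝ) :
    TopologicalSpace (weightedSpace w) :=
  (weightedNorm w).moduleFilterBasis.topology

/-- The weights `x^β / (β! e^{-h(β)})`, for all multi-indices `β`. -/
def weightG {n : ℕ} (h : EuclideanSpace ℝ (Fin n) → ℝ) (β : Fin n → ℕ)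
    (x : EuclideanSpace ℝ (Fin n)) : ℝ :=
  (∏ j, x j ^ β j) / ((∏ j, (Nat.factorial (β j) : ℝ)) * Real.exp (-h (vec fun j => (β j : ℝ))))

/-- The single weight `1 / e^{-M(x)}`. -/
def weightGS {n : ℕ} (M : EuclideanSpace ℝ (Fin n) → ℝ) (_ : Unit)
    (x : EuclideanSpace ℝ (Fin n)) : ℝ :=
  1 / Real.exp (-M x)

/-- The linear span of the union of a sequence of subspaces: it is the union itself if the
sequence increases. -/
def limitSpace {n : ℕ} {ι : Type} (w : ℕ → ι → EuclideanSpace ℝ (Fin n) → ℝ) :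
    Submodule ℂ (EuclideanSpace ℝ (Fin n) → ℂ) :=
  ⨆ ν, weightedSpace (w ν)

/-- The inclusion of the `ν`-th space. -/
def limitInclusion {n : ℕ} {ι : Type} (w : ℕ → ι → EuclideanSpace ℝ (Fin n) → ℝ) (ν : ℕ) :
    weightedSpace (w ν) →ₗ[ℂ] limitSpace w :=
  Submodule.inclusion (le_iSup (fun ν => weightedSpace (w ν)) ν)

/-- The (locally convex) inductive limit topology: the finest locally convex vector space topology
for which all the inclusions are continuous. -/
@[reducible] def limitTopology {n : ℕ} {ι : Type} (w : ℕ → ι → EuclideanSpace ℝ (Fin n) → ℝ) :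
    TopologicalSpace (limitSpace w) :=
  sInf {t | (∀ ν, @Continuous _ _ (weightedTopology (w ν)) t (limitInclusion w ν)) ∧
    @IsTopologicalAddGroup _ t _ ∧ @ContinuousSMul ℂ _ _ _ t ∧
    @LocallyConvexSpace ℝ _ _ _ _ _ t}

/-- The space `G(H)` for `H = (h ν)` is `limitSpace (weightsG h)`. -/
def weightsG {n : ℕ} (h : ℕ → EuclideanSpace ℝ (Fin n) → ℝ) :
    ℕ → (Fin n → ℕ) → EuclideanSpace ℝ (Fin n) → ℝ :=
  fun ν => weightG (h ν)

/-- The space `GS(M)` for `M = (M ν)` is `limitSpace (weightsGS M)`. -/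
def weightsGS {n : ℕ} (M : ℕ → EuclideanSpace ℝ (Fin n) → ℝ) :
    ℕ → Unit → EuclideanSpace ℝ (Fin n) → ℝ :=
  fun ν => weightGS (M ν)

/-- The family `Φ*` of conjugates of the functions `φ ν`. -/
def phiStar {n : ℕ} (h : ℕ → EuclideanSpace ℝ (Fin n) → ℝ) :
    ℕ → EuclideanSpace ℝ (Fin n) → ℝ :=
  fun ν => conj (phi (h ν))

end

/-! Both scales are defined by the same derivatives and differ only in their weights. So it suffices
to compare, at each point x and up to a shift of ν, the supremum over β of |x^β| e^{h_ν(β)} / β!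
with e^{φ_ν*(x)}.

From monomials to the exponential (`exp_inner_sub_phi_le`): given y, take β_j to be the integer part
of t_j = |x_j|(1+|y_j|). Young's inequality for h* at t, together with β! ≤ t^β, bounds
e^{⟨x,y⟩-φ(y)} by one monomial weight. Condition 6) pays for rounding t, condition 5) for the
remaining linear terms.

From the exponential to monomials (`weightGS_controls_weightG`): given β, take an approximate
subgradient u ≥ 0 of h_{ν+1} at β and test φ_ν* at y_j = ±e^{u_j}. The estimate s^k/k! ≤ e^s
produces the monomial, and condition 5) absorbs ln(1+e^{u_j}) ≤ ln 2 + u_j.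

The resulting inclusions of the steps are continuous both ways, so the inductive limits agree. -/

/-- The weights `w` control the weights `w'`: a bound for all `|w i x| z` bounds all `|w' k x| z`. -/
def WeightControls {n : ℕ} {ι κ : Type} (w : ι → EuclideanSpace ℝ (Fin n) → ℝ)
    (w' : κ → EuclideanSpace ℝ (Fin n) → ℝ) : Prop :=
  ∃ C : ℝ, 0 ≤ C ∧ ∀ (x : EuclideanSpace ℝ (Fin n)) (z N : ℝ), 0 ≤ z →
    (∀ i, |w i x| * z ≤ N) → ∀ k, |w' k x| * z ≤ C * N

/-! ### Controlled weights give continuous inclusions of function spaces. -/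

section Inclusion

variable {n : ℕ} {ι κ : Type} {w : ι → EuclideanSpace ℝ (Fin n) → ℝ}
  {w' : κ → EuclideanSpace ℝ (Fin n) → ℝ}

/-- The control is applied pointwise with z = |D^α f(x)|, so the order m is preserved and no
derivative has to be estimated. -/
theorem weightedVal_le_of_controls {C : ℝ}
    (hC : ∀ (x : EuclideanSpace ℝ (Fin n)) (z N : ℝ), 0 ≤ z →
      (∀ i, |w i x| * z ≤ N) → ∀ k, |w' k x| * z ≤ C * N)
    {m : ℕ} {f : EuclideanSpace ℝ (Fin n) → ℂ} {N : ℝ} (hN : ∀ p, weightedVal w m f p ≤ N)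
    (p : {α : Fin n → ℕ // ∑ j, α j ≤ m} × κ × EuclideanSpace ℝ (Fin n)) :
    weightedVal w' m f p ≤ C * N := by
  obtain ⟨α, k, x⟩ := p
  have := hC x ‖multiDeriv α.1 f x‖ N (norm_nonneg _)
    (fun i => by simpa [weightedVal, norm_smul] using hN (α, i, x)) k
  simpa [weightedVal, norm_smul] using this

theorem WeightControls.weightedSpace_le (hw : WeightControls w w') :
    weightedSpace w ≤ weightedSpace w' := by
  obtain ⟨C, -, hC⟩ := hw
  intro f hf
  refine (Submodule.mem_iInf _).2 fun m => ?_
  obtain ⟨h1, N, hN⟩ := (Submodule.mem_iInf _).1 hf m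
  refine ⟨h1, C * N, ?_⟩
  rintro _ ⟨p, rfl⟩
  exact weightedVal_le_of_controls hC (fun p => hN ⟨p, rfl⟩) p

theorem weightedNorm_apply (w : ι → EuclideanSpace ℝ (Fin n) → ℝ) (m : ℕ) (f : weightedSpace w) :
    weightedNorm w m f = ⨆ p, weightedVal w m (f : EuclideanSpace ℝ (Fin n) → ℂ) p :=
  rfl

theorem withSeminorms_weightedTopology (w : ι → EuclideanSpace ℝ (Fin n) → ℝ) :
    @WithSeminorms ℂ (weightedSpace w) ℕ _ _ _ (weightedNorm w) (weightedTopology w) :=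
  @WithSeminorms.mk ℂ (weightedSpace w) ℕ _ _ _ (weightedNorm w) (weightedTopology w) rfl

theorem WeightControls.isBounded_inclusion (hw : WeightControls w w') :
    Seminorm.IsBounded (weightedNorm w) (weightedNorm w')
      (Submodule.inclusion hw.weightedSpace_le) := by
  intro m
  obtain ⟨C, hC0, hC⟩ := id hw
  lift C to NNReal using hC0
  refine ⟨{m}, C, fun f => ?_⟩
  have hb := (weightedSpace_prop f m).2
  rw [Finset.sup_singleton, Seminorm.comp_apply, smul_apply, weightedNorm_apply,
    weightedNorm_apply, Submodule.coe_inclusion, NNReal.smul_def, smul_eq_mul]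
  exact Real.iSup_le (weightedVal_le_of_controls hC fun p => le_ciSup hb p)
    (mul_nonneg C.2 (Real.iSup_nonneg fun _ => norm_nonneg _))

theorem WeightControls.continuous_inclusion (hw : WeightControls w w') :
    @Continuous _ _ (weightedTopology w) (weightedTopology w')
      (Submodule.inclusion hw.weightedSpace_le) :=
  WithSeminorms.continuous_of_isBounded (withSeminorms_weightedTopology w)
    (withSeminorms_weightedTopology w') _ hw.isBounded_inclusion

end Inclusion

/-! ### Inductive limits of interlaced scales. -/

section Limit

variable {n : ℕ} {ι κ : Type} {w : ℕ → ι → EuclideanSpace ℝ (Fin n) → ℝ}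
  {w' : ℕ → κ → EuclideanSpace ℝ (Fin n) → ℝ}

theorem continuous_limitInclusion (ν : ℕ) :
    @Continuous _ _ (weightedTopology (w ν)) (limitTopology w) (limitInclusion w ν) :=
  continuous_sInf_rng.2 fun _ ht => ht.1 ν

theorem continuous_inclusion_limitTopology (h : ∀ ν, ∃ μ, WeightControls (w ν) (w' μ))
    (hle : limitSpace w ≤ limitSpace w') :
    @Continuous _ _ (limitTopology w) (limitTopology w') (Submodule.inclusion hle) := by
  let _t' := limitTopology w'
  have : IsTopologicalAddGroup (limitSpace w') := topologicalAddGroup_sInf fun _ ht => ht.2.1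
  have : ContinuousSMul ℂ (limitSpace w') := continuousSMul_sInf fun _ ht => ht.2.2.1
  have : LocallyConvexSpace ℝ (limitSpace w') := LocallyConvexSpace.sInf fun _ ht => ht.2.2.2
  -- The topology induced from the target is one of the competitors in the infimum defining the
  -- source topology.
  refine continuous_iff_le_induced.2 (sInf_le ⟨fun ν => ?_, ?_, ?_, ?_⟩)
  · obtain ⟨μ, hμ⟩ := h ν
    have key : @Continuous _ _ (weightedTopology (w ν)) (limitTopology w')
        (limitInclusion w' μ ∘ Submodule.inclusion hμ.weightedSpace_le) :=
      @Continuous.comp _ _ _ (weightedTopology (w ν)) (weightedTopology (w' μ)) (limitTopology w')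
        _ _ (continuous_limitInclusion μ) hμ.continuous_inclusion
    have hcomp : limitInclusion w' μ ∘ Submodule.inclusion hμ.weightedSpace_le =
        Submodule.inclusion hle ∘ limitInclusion w ν := funext fun f => Subtype.ext rfl
    rw [hcomp] at key
    exact continuous_induced_rng.2 key
  · exact topologicalAddGroup_induced (Submodule.inclusion hle)
  · exact continuousSMul_induced (Submodule.inclusion hle)
  · exact LocallyConvexSpace.induced ((Submodule.inclusion hle).restrictScalars ℝ)

theorem limitSpace_le_of_controls (h : ∀ ν, ∃ μ, WeightControls (w ν) (w' μ)) :
    limitSpace w ≤ limitSpace w' :=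
  iSup_le fun ν => let ⟨μ, hμ⟩ := h ν
    hμ.weightedSpace_le.trans (le_iSup (fun ν => weightedSpace (w' ν)) μ)

theorem coe_limitSpace_of_directed
    (h : ∀ ν μ, ∃ k, WeightControls (w ν) (w k) ∧ WeightControls (w μ) (w k)) :
    (limitSpace w : Set (EuclideanSpace ℝ (Fin n) → ℂ)) =
      ⋃ ν, (weightedSpace (w ν) : Set (EuclideanSpace ℝ (Fin n) → ℂ)) :=
  Submodule.coe_iSup_of_directed _ fun ν μ =>
    let ⟨k, h1, h2⟩ := h ν μ
    ⟨k, h1.weightedSpace_le, h2.weightedSpace_le⟩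

theorem exists_isHomeomorph_limitTopology (h : ∀ ν, ∃ μ, WeightControls (w ν) (w' μ))
    (h' : ∀ ν, ∃ μ, WeightControls (w' ν) (w μ)) :
    ∃ e : limitSpace w = limitSpace w',
      @IsHomeomorph _ _ (limitTopology w) (limitTopology w') (LinearEquiv.ofEq _ _ e) := by
  have e := le_antisymm (limitSpace_le_of_controls h) (limitSpace_le_of_controls h')
  refine ⟨e, ?_⟩
  let := limitTopology w
  let := limitTopology w'
  let φ : limitSpace w ≃ₜ limitSpace w' :=
    { (LinearEquiv.ofEq _ _ e).toEquiv with
      continuous_toFun := continuous_inclusion_limitTopology h e.le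
      continuous_invFun := continuous_inclusion_limitTopology h' e.ge }
  exact φ.isHomeomorph

end Limit

/-! ### The explicit weights and their dependence on ν. -/

theorem WeightControls.trans {n : ℕ} {ι κ σ : Type} {w : ι → EuclideanSpace ℝ (Fin n) → ℝ}
    {w' : κ → EuclideanSpace ℝ (Fin n) → ℝ} {w'' : σ → EuclideanSpace ℝ (Fin n) → ℝ}
    (h : WeightControls w w') (h' : WeightControls w' w'') : WeightControls w w'' := by
  obtain ⟨C, hC0, hC⟩ := h
  obtain ⟨D, hD0, hD⟩ := h'
  refine ⟨D * C, mul_nonneg hD0 hC0, fun x z N hz hN k => ?_⟩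
  rw [mul_assoc]
  exact hD x z _ hz (hC x z N hz hN) k

theorem abs_weightG {n : ℕ} (h : EuclideanSpace ℝ (Fin n) → ℝ) (β : Fin n → ℕ)
    (x : EuclideanSpace ℝ (Fin n)) :
    |weightG h β x| =
      (∏ j, |x j| ^ β j / (β j).factorial) * Real.exp (h (vec fun j => (β j : ℝ))) := by
  rw [weightG, abs_div, abs_mul, Finset.abs_prod, Finset.abs_prod, Real.abs_exp, Real.exp_neg,
    Finset.prod_div_distrib]
  simp only [abs_pow, Nat.abs_cast]
  field_simp

theorem abs_weightGS {n : ℕ} (M : EuclideanSpace ℝ (Fin n) → ℝ) (u : Unit)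
    (x : EuclideanSpace ℝ (Fin n)) : |weightGS M u x| = Real.exp (M x) := by
  rw [weightGS, Real.exp_neg, one_div, inv_inv, Real.abs_exp]

/-- With t = x(1+y) and b its integer part, b! ≤ b^b ≤ t^b gives x^b/b! ≥ (1+y)^{-b} ≥ e^{-t
ln(1+y)}, while xy - t ≤ 0. -/
theorem exp_mul_factorial_floor_le {x y : ℝ} (hx : 0 ≤ x) (hy : 0 ≤ y) :
    Real.exp (x * y - x * (1 + y) * Real.log (1 + y) - x * (1 + y)) ≤
      x ^ ⌊x * (1 + y)⌋₊ / (⌊x * (1 + y)⌋₊).factorial := by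
  have ht : 0 ≤ x * (1 + y) := by positivity
  have hb : (⌊x * (1 + y)⌋₊ : ℝ) ≤ x * (1 + y) := Nat.floor_le ht
  set b := ⌊x * (1 + y)⌋₊
  have hlog : 0 ≤ Real.log (1 + y) := Real.log_nonneg (by linarith)
  have hfac : ((b.factorial : ℕ) : ℝ) ≤ x ^ b * (1 + y) ^ b := by
    rw [← mul_pow]
    refine le_trans ?_ (pow_le_pow_left₀ (Nat.cast_nonneg b) hb b)
    exact_mod_cast Nat.factorial_le_pow b
  have hpow : (1 + y) ^ b = Real.exp (b * Real.log (1 + y)) := by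
    rw [Real.exp_nat_mul, Real.exp_log (by linarith)]
  rw [le_div_iff₀ (by positivity)]
  calc Real.exp (x * y - x * (1 + y) * Real.log (1 + y) - x * (1 + y)) * (b.factorial : ℝ)
      ≤ Real.exp (-(b * Real.log (1 + y))) * (x ^ b * (1 + y) ^ b) := by
        refine mul_le_mul (Real.exp_le_exp.2 ?_) hfac (by positivity) (by positivity)
        nlinarith [mul_le_mul_of_nonneg_right hb hlog]
    _ = x ^ b := by
        rw [hpow, mul_left_comm, ← Real.exp_add]; simp

namespace IsWeightFamily

variable {n : ℕ} {h : ℕ → EuclideanSpace ℝ (Fin n) → ℝ}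

theorem weightG_controls_succ (hh : IsWeightFamily h) (ν : ℕ) :
    WeightControls (weightG (h ν)) (weightG (h (ν + 1))) := by
  obtain ⟨γ, hγ⟩ := hh.sub_ge ν
  refine ⟨Real.exp γ, (Real.exp_pos _).le, fun x z N hz hN β => ?_⟩
  refine le_trans ?_ (mul_le_mul_of_nonneg_left (hN β) (Real.exp_pos γ).le)
  rw [← mul_assoc]
  refine mul_le_mul_of_nonneg_right ?_ hz
  rw [abs_weightG, abs_weightG, mul_left_comm, ← Real.exp_add]
  refine mul_le_mul_of_nonneg_left (Real.exp_le_exp.2 ?_)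
    (Finset.prod_nonneg fun j _ => by positivity)
  have h1 := hγ (vec fun j => (β j : ℝ)) (fun j => Nat.cast_nonneg _)
  have h2 : 0 ≤ Real.log 2 * ∑ j, (vec fun j => (β j : ℝ)) j :=
    mul_nonneg (Real.log_nonneg (by norm_num)) (Finset.sum_nonneg fun j _ => Nat.cast_nonneg _)
  linarith

theorem weightG_controls_of_lt (hh : IsWeightFamily h) {ν μ : ℕ} (hνμ : ν < μ) :
    WeightControls (weightG (h ν)) (weightG (h μ)) := by
  induction μ, hνμ using Nat.le_induction with
  | base => exact hh.weightG_controls_succ ν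
  | succ k _ ih => exact ih.trans (hh.weightG_controls_succ k)

/-! ### From the monomial weights to the exponential weight. -/

/-- One index is spent on condition 6), since t ≤ ⌊t⌋ + (1,…,1). Two more are spent on condition 5),
because 2 ln 2 ≥ 1. -/
theorem apply_add_sum_le_apply_floor (hh : IsWeightFamily h) (ν : ℕ) :
    ∃ K : ℝ, ∀ t : Fin n → ℝ, (∀ j, 0 ≤ t j) →
      h (ν + 3) (vec t) + ∑ j, t j ≤ h ν (vec fun j => (⌊t j⌋₊ : ℝ)) + K := by
  obtain ⟨γ₁, hγ₁⟩ := hh.sub_ge (ν + 1)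
  obtain ⟨γ₂, hγ₂⟩ := hh.sub_ge (ν + 2)
  obtain ⟨l, hl⟩ := hh.add_le ν
  refine ⟨h ν (vec fun _ => 1) + l + γ₁ + γ₂, fun t ht => ?_⟩
  have h1 : h (ν + 1) (vec t) - h (ν + 2) (vec t) ≥ Real.log 2 * ∑ j, t j - γ₁ := hγ₁ (vec t) ht
  have h2 : h (ν + 2) (vec t) - h (ν + 3) (vec t) ≥ Real.log 2 * ∑ j, t j - γ₂ := hγ₂ (vec t) ht
  have h3 : h (ν + 1) (vec t) ≤
      h (ν + 1) ((vec fun j => (⌊t j⌋₊ : ℝ)) + vec fun _ => 1) :=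
    hh.mono _ _ _ ht fun j => (Nat.lt_floor_add_one (t j)).le
  have h4 := hl (vec fun j => (⌊t j⌋₊ : ℝ)) (vec fun _ => 1) (fun j => Nat.cast_nonneg _)
    (fun j => zero_le_one)
  have h5 : 0 ≤ ∑ j, t j := Finset.sum_nonneg fun j _ => ht j
  have h6 : (1 / 2 : ℝ) * ∑ j, t j ≤ Real.log 2 * ∑ j, t j :=
    mul_le_mul_of_nonneg_right (by linarith [Real.log_two_gt_d9]) h5
  linarith

theorem exp_inner_sub_phi_le (hh : IsWeightFamily h) (ν : ℕ) :
    ∃ K : ℝ, ∀ x y : EuclideanSpace ℝ (Fin n), ∃ β : Fin n → ℕ,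
      Real.exp (⟪x, y⟫ - phi (h (ν + 3)) y) ≤ Real.exp K * |weightG (h ν) β x| := by
  obtain ⟨K, hK⟩ := hh.apply_add_sum_le_apply_floor ν
  refine ⟨K, fun x y => ?_⟩
  set t : Fin n → ℝ := fun j => |x j| * (1 + |y j|) with ht
  have ht0 : ∀ j, 0 ≤ t j := fun j => by positivity
  refine ⟨fun j => ⌊t j⌋₊, ?_⟩
  have h1 := (hh.isLUB_conj (ν + 3) (vec fun j => Real.log (1 + |y j|))).1 ⟨vec t, rfl⟩
  change ⟪_, _⟫ - _ ≤ phi (h (ν + 3)) y at h1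
  have h2 : ⟪vec fun j => Real.log (1 + |y j|), vec t⟫ = ∑ j, t j * Real.log (1 + |y j|) := by
    rw [PiLp.inner_apply]; exact Finset.sum_congr rfl fun j _ => by simp [vec]
  have h3 : ⟪x, y⟫ ≤ ∑ j, |x j| * |y j| := by
    rw [PiLp.inner_apply]
    refine Finset.sum_le_sum fun j _ => ?_
    simpa using real_inner_le_norm (x j) (y j)
  have h4 := hK t ht0
  have h5 : ∑ j, (|x j| * |y j| - t j * Real.log (1 + |y j|) - t j) =
      ∑ j, |x j| * |y j| - ∑ j, t j * Real.log (1 + |y j|) - ∑ j, t j := by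
    simp only [Finset.sum_sub_distrib]
  rw [h2] at h1
  calc Real.exp (⟪x, y⟫ - phi (h (ν + 3)) y)
      ≤ Real.exp (K + (∑ j, (|x j| * |y j| - t j * Real.log (1 + |y j|) - t j) +
          h ν (vec fun j => (⌊t j⌋₊ : ℝ)))) := Real.exp_le_exp.2 (by linarith)
    _ ≤ _ := by
      rw [Real.exp_add, Real.exp_add, Real.exp_sum, abs_weightG]
      gcongr with j
      exact exp_mul_factorial_floor_le (abs_nonneg _) (abs_nonneg _)

theorem weightG_controls_weightGS (hh : IsWeightFamily h) (ν : ℕ) :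
    WeightControls (weightG (h ν)) (weightGS (phiStar h (ν + 3))) := by
  obtain ⟨K, hK⟩ := hh.exp_inner_sub_phi_le ν
  refine ⟨Real.exp K, (Real.exp_pos _).le, fun x z N hz hN u => ?_⟩
  rw [abs_weightGS]
  have hN0 : 0 ≤ N := (mul_nonneg (abs_nonneg _) hz).trans (hN 0)
  -- For z > 0 one may divide by z and take logarithms, turning the claim into an upper bound for
  -- the supremum defining φ*(x).
  rcases hz.eq_or_lt with rfl | hz
  · rw [mul_zero]; positivity
  have hle : ∀ y, Real.exp (⟪x, y⟫ - phi (h (ν + 3)) y) ≤ Real.exp K * N / z := fun y => by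
    obtain ⟨β, hβ⟩ := hK x y
    rw [le_div_iff₀ hz]
    calc _ ≤ Real.exp K * |weightG (h ν) β x| * z := mul_le_mul_of_nonneg_right hβ hz.le
      _ = Real.exp K * (|weightG (h ν) β x| * z) := mul_assoc _ _ _
      _ ≤ _ := mul_le_mul_of_nonneg_left (hN β) (Real.exp_pos K).le
  have hpos : 0 < Real.exp K * N / z := (Real.exp_pos _).trans_le (hle 0)
  rw [← le_div_iff₀ hz, ← Real.le_log_iff_exp_le hpos]
  refine (hh.isLUB_conj_phi (ν + 3) x).2 ?_
  rintro _ ⟨y, rfl⟩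
  exact (Real.le_log_iff_exp_le hpos).2 (hle y)

/-! ### From the exponential weight to the monomial weights. -/

/-- Up to an error of `1`, the supremum defining `h ν = (h ν)**` at a point of the orthant is
attained at a point of the orthant. -/
theorem exists_approx_subgradient (hh : IsWeightFamily h) (ν : ℕ) (b : EuclideanSpace ℝ (Fin n))
    (hb : ∀ j, 0 ≤ b j) :
    ∃ u : Fin n → ℝ, (∀ j, 0 ≤ u j) ∧ ∀ t : EuclideanSpace ℝ (Fin n), (∀ j, 0 ≤ t j) →
      ∑ j, u j * t j - h ν t ≤ ∑ j, u j * b j - h ν b + 1 := by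
  have hc : Continuous (h ν) := continuousOn_univ.1 ((hh.convex ν).continuousOn isOpen_univ)
  -- An affine minorant equal to h(b) - 1 at b replaces an exact subgradient; this is the source of
  -- the error 1.
  obtain ⟨l, c, hlc, hlb⟩ := (hh.convex ν).exists_affine_le_of_lt (𝕜 := ℝ) (Set.mem_univ b)
    (sub_one_lt (h ν b)) isClosed_univ (hc.lowerSemicontinuous.lowerSemicontinuousOn _)
  have hlc' : ∀ t, l t + c ≤ h ν t := fun t => hlc ⟨t, trivial⟩
  have hlb' : l b + c = h ν b - 1 := hlb
  set v : EuclideanSpace ℝ (Fin n) := (InnerProductSpace.toDual ℝ _).symm l with hv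
  have hl : ∀ t, l t = ∑ j, v j * t j := fun t => by
    rw [← InnerProductSpace.toDual_symm_apply (𝕜 := ℝ) (x := t) (y := l), PiLp.inner_apply]
    exact Finset.sum_congr rfl fun j _ => by simp [hv, mul_comm]
  refine ⟨fun j => |v j|, fun j => abs_nonneg _, fun t ht => ?_⟩
  -- By the symmetry of h, reflecting t to match the signs of v lets |v| serve as slope on the
  -- orthant; as b ≥ 0, this only increases the linear part at b.
  set s : EuclideanSpace ℝ (Fin n) := vec fun j => if 0 ≤ v j then t j else -t j with hs
  have hsj : ∀ j, s j = if 0 ≤ v j then t j else -t j := fun j => rfl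
  have hst : h ν s = h ν t := by
    rw [hh.abs_eq ν s, hh.abs_eq ν t]
    congr 2
    funext j
    rw [hsj]
    split_ifs <;> simp
  have h1 := hlc' s
  rw [hl, hst] at h1
  rw [hl] at hlb'
  have h2 : ∑ j, v j * s j = ∑ j, |v j| * t j := Finset.sum_congr rfl fun j _ => by
    rw [hsj]
    split_ifs with hvj
    · rw [abs_of_nonneg hvj]
    · rw [abs_of_neg (not_le.1 hvj)]; ring
  have h3 : ∑ j, v j * b j ≤ ∑ j, |v j| * b j := Finset.sum_le_sum fun j _ =>
    mul_le_mul_of_nonneg_right (le_abs_self _) (hb j)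
  linarith

/-- Since u ≥ 0, ln(1+e^{u_j}) ≤ ln 2 + u_j, and the excess ln 2 · Σ|t_j| is what h_ν gains over
h_{ν+1}, up to γ. -/
theorem phi_exp_le (hh : IsWeightFamily h) {ν : ℕ} {γ B : ℝ}
    (hγ : ∀ t : EuclideanSpace ℝ (Fin n), (∀ j, 0 ≤ t j) →
      h ν t - h (ν + 1) t ≥ Real.log 2 * (∑ j, t j) - γ)
    {u : Fin n → ℝ} (hu0 : ∀ j, 0 ≤ u j)
    (hu : ∀ t : EuclideanSpace ℝ (Fin n), (∀ j, 0 ≤ t j) → ∑ j, u j * t j - h (ν + 1) t ≤ B)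
    {y : EuclideanSpace ℝ (Fin n)} (hy : ∀ j, |y j| = Real.exp (u j)) :
    phi (h ν) y ≤ B + γ := by
  refine (hh.isLUB_conj ν _).2 ?_
  rintro _ ⟨t, rfl⟩
  have h1 := hγ (vec fun j => |t j|) fun j => abs_nonneg _
  have h2 := hu (vec fun j => |t j|) fun j => abs_nonneg _
  have h3 : ⟪vec fun j => Real.log (1 + |y j|), t⟫ ≤ ∑ j, (Real.log 2 * |t j| + u j * |t j|) := by
    rw [PiLp.inner_apply]
    refine Finset.sum_le_sum fun j _ => ?_
    have hexp : 1 ≤ Real.exp (u j) := Real.one_le_exp (hu0 j)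
    have hlog : Real.log (1 + |y j|) ≤ Real.log 2 + u j := by
      rw [hy, Real.log_le_iff_le_exp (by positivity), Real.exp_add, Real.exp_log two_pos]
      linarith
    have hlog0 : 0 ≤ Real.log (1 + |y j|) := Real.log_nonneg (by linarith [abs_nonneg (y j)])
    have h4 := real_inner_le_norm (Real.log (1 + |y j|)) (t j)
    rw [Real.norm_eq_abs, Real.norm_eq_abs, abs_of_nonneg hlog0] at h4
    have h5 := mul_le_mul_of_nonneg_right hlog (abs_nonneg (t j))
    rw [← add_mul]
    exact h4.trans h5
  rw [Finset.sum_add_distrib, ← Finset.mul_sum] at h3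
  have h6 := hh.abs_eq ν t
  change h ν _ - h (ν + 1) _ ≥ Real.log 2 * (∑ j, |t j|) - γ at h1
  change ∑ j, u j * |t j| - h (ν + 1) _ ≤ B at h2
  change ⟪vec fun j => Real.log (1 + |y j|), t⟫ - h ν t ≤ B + γ
  linarith

theorem weightGS_controls_weightG (hh : IsWeightFamily h) (ν : ℕ) :
    WeightControls (weightGS (phiStar h ν)) (weightG (h (ν + 1))) := by
  obtain ⟨γ, hγ⟩ := hh.sub_ge ν
  refine ⟨Real.exp (γ + 1), (Real.exp_pos _).le, fun x z N hz hN β => ?_⟩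
  refine le_trans ?_ (mul_le_mul_of_nonneg_left (hN ()) (Real.exp_pos _).le)
  rw [← mul_assoc]
  refine mul_le_mul_of_nonneg_right ?_ hz
  rw [abs_weightG, abs_weightGS, ← Real.exp_add]
  set b : EuclideanSpace ℝ (Fin n) := vec fun j => (β j : ℝ) with hb
  obtain ⟨u, hu0, hu⟩ := hh.exists_approx_subgradient (ν + 1) b fun j => Nat.cast_nonneg _
  -- The signs of y follow those of x, so that ⟨x,y⟩ = Σ|x_j| e^{u_j}.
  set y : EuclideanSpace ℝ (Fin n) :=
    vec fun j => if 0 ≤ x j then Real.exp (u j) else -Real.exp (u j) with hy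
  have hyj : ∀ j, y j = if 0 ≤ x j then Real.exp (u j) else -Real.exp (u j) := fun j => rfl
  have h1 : phi (h ν) y ≤ _ := hh.phi_exp_le hγ hu0 hu (y := y) fun j => by
    rw [hyj]; split_ifs <;> simp
  have h2 : ⟪x, y⟫ - phi (h ν) y ≤ phiStar h ν x := (hh.isLUB_conj_phi ν x).1 ⟨y, rfl⟩
  have h3 : ⟪x, y⟫ = ∑ j, |x j| * Real.exp (u j) := by
    rw [PiLp.inner_apply]
    refine Finset.sum_congr rfl fun j _ => ?_
    rw [hyj]
    split_ifs with hx
    · simp [abs_of_nonneg hx, mul_comm]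
    · simp [abs_of_neg (not_le.1 hx), mul_comm]
  have h4 : ∏ j, |x j| ^ β j / (β j).factorial ≤
      Real.exp (∑ j, (|x j| * Real.exp (u j) - u j * b j)) := by
    rw [Real.exp_sum]
    refine Finset.prod_le_prod (fun j _ => by positivity) fun j _ => ?_
    have h5 := Real.pow_div_factorial_le_exp (x := |x j| * Real.exp (u j)) (by positivity) (β j)
    have h6 : Real.exp (u j * b j) = Real.exp (u j) ^ β j := by
      rw [← Real.exp_nat_mul, mul_comm]; rfl
    rw [Real.exp_sub, h6, le_div_iff₀ (by positivity)]
    calc _ = (|x j| * Real.exp (u j)) ^ β j / (β j).factorial := by rw [mul_pow]; ring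
      _ ≤ _ := h5
  calc _ ≤ Real.exp (∑ j, (|x j| * Real.exp (u j) - u j * b j)) * Real.exp (h (ν + 1) b) :=
        mul_le_mul_of_nonneg_right h4 (Real.exp_pos _).le
    _ ≤ _ := by
      rw [← Real.exp_add, Finset.sum_sub_distrib]
      exact Real.exp_le_exp.2 (by linarith)

end IsWeightFamily

theorem theorem4 (n : ℕ) (h : ℕ → EuclideanSpace ℝ (Fin n) → ℝ) (hh : IsWeightFamily h)
    (hconv : ∀ ν, ConvexOn ℝ Set.univ (phi (h ν))) :
    (limitSpace (weightsG h) : Set (EuclideanSpace ℝ (Fin n) → ℂ)) =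
        ⋃ ν, (weightedSpace (weightG (h ν)) : Set (EuclideanSpace ℝ (Fin n) → ℂ)) ∧
      (limitSpace (weightsGS (phiStar h)) : Set (EuclideanSpace ℝ (Fin n) → ℂ)) =
        ⋃ ν, (weightedSpace (weightGS (phiStar h ν)) : Set (EuclideanSpace ℝ (Fin n) → ℂ)) ∧
      ∃ e : limitSpace (weightsG h) = limitSpace (weightsGS (phiStar h)),
        @IsHomeomorph _ _ (limitTopology (weightsG h)) (limitTopology (weightsGS (phiStar h)))
          (LinearEquiv.ofEq _ _ e) := by
  have hG (ν : ℕ) := hh.weightG_controls_weightGS ν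
  have hGS (ν : ℕ) := hh.weightGS_controls_weightG ν
  refine ⟨coe_limitSpace_of_directed fun ν μ => ⟨max ν μ + 1, ?_, ?_⟩,
    -- Directedness of the second scale passes through the first: ν to ν+1, then to max+2 (strictly
    -- larger), then the shift by 3 back.
    coe_limitSpace_of_directed fun ν μ => ⟨max ν μ + 2 + 3, ?_, ?_⟩,
    exists_isHomeomorph_limitTopology (fun ν => ⟨ν + 3, hG ν⟩) fun ν => ⟨ν + 1, hGS ν⟩⟩
  · exact hh.weightG_controls_of_lt (by omega)
  · exact hh.weightG_controls_of_lt (by omega)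
  · exact ((hGS ν).trans (hh.weightG_controls_of_lt (by omega))).trans (hG (max ν μ + 2))
  · exact ((hGS μ).trans (hh.weightG_controls_of_lt (by omega))).trans (hG (max ν μ + 2))
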